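/- Let $d_A,d_B$ be natural numbers and let $U$ be a permutation unitary on $\mathbb{C}^{d_A}\otimes\mathbb{C}^{d_B}$, i.e. a unitary $d_Ad_B\times d_Ad_B$ matrix (in the computational product basis) all of whose entries are $0$ or $1$. Suppose that $U$ has Schmidt rank four, i.e. $U=\sum_{j=1}^4 S_j\otimes T_j$ with linearly independent $d_A\times d_A$ matrices $S_1,\dots,S_4$ and linearly independent $d_B\times d_B$ matrices $T_1,\dots,T_4$. Then $U$ can be implemented by local operations and classical communication (LOCC), in one shot, exactly and deterministically, with the help of not more than $10.71$ ebits of entanglement. That is, there are an integer $N\ge 1$ with $\log_2 N\le 10.71$ and an LOCC protocol between Alice and Bob (finitely many rounds; in each round one party applies a measurement, given by finitely many Kraus operators $K_i$ with $\sum_i K_i^\dagger K_i=I$, to a finite-dimensional local system and communicates the outcome to the other party) such that, whenever Alice and Bob share a state $\rho$ on $\mathbb{C}^{d_A}\otimes\mathbb{C}^{d_B}$ and in addition the maximally entangled state $\frac{1}{\sqrt N}\sum_{k=1}^{N}|k\rangle|k\rangle$, the protocol outputs the state $U\rho U^\dagger$. -/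

import Mathlib

open scoped Kronecker Matrix ComplexOrder

/-- A permutation unitary: a unitary matrix all of whose entries are `0` or `1`. -/
def IsPermutationUnitary {n : Type} [Fintype n] [DecidableEq n] (U : Matrix n n ℂ) : Prop :=
  U ∈ Matrix.unitaryGroup n ℂ ∧ ∀ i j, U i j = 0 ∨ U i j = 1

/-- The operator `U` on `ℂ^A ⊗ ℂ^B` has (operator-)Schmidt rank `r`: it is a sum of `r` products
`S j ⊗ T j` with `S` linearly independent and `T` linearly independent. -/
def HasSchmidtRank {A B : Type} (U : Matrix (A × B) (A × B) ℂ) (r : ℕ) : Prop :=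
  ∃ (S : Fin r → Matrix A A ℂ) (T : Fin r → Matrix B B ℂ),
    LinearIndependent ℂ S ∧ LinearIndependent ℂ T ∧ U = ∑ j, S j ⊗ₖ T j

/-- Density matrices. -/
def IsDensityMatrix {n : Type} [Fintype n] (ρ : Matrix n n ℂ) : Prop :=
  ρ.PosSemidef ∧ ρ.trace = 1

/-- `LOCCProtocol A' B' A B` is the type of finite LOCC protocols which start with Alice holding
`ℂ^A` and Bob holding `ℂ^B`, and end with Alice holding `ℂ^A'` and Bob holding `ℂ^B'`.
In each step one of the parties applies a generalized measurement to the local system, with Kraus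
operators `K i` satisfying `∑ i, K i ^* K i = 1`, and sends the outcome `i` to the other party;
all later steps may depend on `i`. Adding local ancillas, local unitaries and discarding local
systems are special cases of such steps. All systems are finite dimensional, each measurement has
finitely many outcomes, and the number of rounds is finite. -/
inductive LOCCProtocol (A' B' : Type) : Type → Type → Type 1
  | done : LOCCProtocol A' B' A' B'
  | alice {A B A₁ ι : Type} [Fintype A] [DecidableEq A] [Fintype B] [DecidableEq B]
      [Fintype A₁] [DecidableEq A₁] [Fintype ι]
      (K : ι → Matrix A₁ A ℂ) (hK : ∑ i, (K i)ᴴ * K i = 1)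
      (next : ι → LOCCProtocol A' B' A₁ B) : LOCCProtocol A' B' A B
  | bob {A B B₁ ι : Type} [Fintype A] [DecidableEq A] [Fintype B] [DecidableEq B]
      [Fintype B₁] [DecidableEq B₁] [Fintype ι]
      (K : ι → Matrix B₁ B ℂ) (hK : ∑ i, (K i)ᴴ * K i = 1)
      (next : ι → LOCCProtocol A' B' A B₁) : LOCCProtocol A' B' A B

/-- The quantum channel realized by a protocol: the final state, summed over all the measurement
outcomes (each branch being weighted by its probability), as a function of the initial state. -/
noncomputable def LOCCProtocol.channel {A' B' : Type} {A B : Type} :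
    LOCCProtocol A' B' A B → Matrix (A × B) (A × B) ℂ → Matrix (A' × B') (A' × B') ℂ
  | .done, ρ => ρ
  | @LOCCProtocol.alice _ _ _ B _ _ _ _ _ _ _ _ _ K _ next, ρ =>
      ∑ i, (next i).channel
        ((K i ⊗ₖ (1 : Matrix B B ℂ)) * ρ * (K i ⊗ₖ (1 : Matrix B B ℂ))ᴴ)
  | @LOCCProtocol.bob _ _ A _ _ _ _ _ _ _ _ _ _ K _ next, ρ =>
      ∑ i, (next i).channel
        (((1 : Matrix A A ℂ) ⊗ₖ K i) * ρ * ((1 : Matrix A A ℂ) ⊗ₖ K i)ᴴ)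

/-- The maximally entangled state `(1/√N) ∑ k, |k⟩|k⟩` of Schmidt rank `N`. -/
noncomputable def maxEntangledKet (N : ℕ) : Fin N × Fin N → ℂ :=
  fun p => if p.1 = p.2 then ((1 / Real.sqrt N : ℝ) : ℂ) else 0

/-- The state `ρ` of `ℂ^A ⊗ ℂ^B` together with a maximally entangled state of Schmidt rank `N`,
Alice holding the first half of the latter and Bob the second half. -/
noncomputable def withMaxEntangled {A B : Type} (N : ℕ) (ρ : Matrix (A × B) (A × B) ℂ) :
    Matrix ((A × Fin N) × (B × Fin N)) ((A × Fin N) × (B × Fin N)) ℂ :=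
  Matrix.of fun x y =>
    ρ (x.1.1, x.2.1) (y.1.1, y.2.1) *
      (maxEntangledKet N (x.1.2, x.2.2) * star (maxEntangledKet N (y.1.2, y.2.2)))

/-- The protocol `p`, consuming a shared maximally entangled state of Schmidt rank `N`, implements
`U` exactly and deterministically on one copy: every input state `ρ` is mapped to `U ρ U^*`. -/
def LOCCProtocol.Implements {A B : Type} [Fintype A] [DecidableEq A] [Fintype B] [DecidableEq B]
    {N : ℕ} (p : LOCCProtocol A B (A × Fin N) (B × Fin N)) (U : Matrix (A × B) (A × B) ℂ) : Prop :=
  ∀ ρ : Matrix (A × B) (A × B) ℂ, IsDensityMatrix ρ →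
    p.channel (withMaxEntangled N ρ) = U * ρ * Uᴴ

/-- `U` can be implemented by LOCC with at most `E` ebits: some LOCC protocol implements `U` with
the help of a maximally entangled state of some Schmidt rank `N ≥ 1`, that is of `log₂ N` ebits,
where `log₂ N ≤ E`. -/
def ImplementableWithEbits {A B : Type} [Fintype A] [DecidableEq A] [Fintype B] [DecidableEq B]
    (U : Matrix (A × B) (A × B) ℂ) (E : ℝ) : Prop :=
  ∃ N : ℕ, 1 ≤ N ∧ Real.logb 2 N ≤ E ∧
    ∃ p : LOCCProtocol A B (A × Fin N) (B × Fin N), p.Implements U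

set_option linter.unusedSectionVars false

section Protocols

variable {A' B' X Y X' S K H ι : Type}

/-- Some LOCC protocol turns the (unnormalized) state `J ρ J^*` into `T ρ T^*`, for all `ρ`. -/
def Realizable (J : Matrix (X × Y) S ℂ) (T : Matrix (A' × B') S ℂ) [Fintype S] : Prop :=
  ∃ p : LOCCProtocol A' B' X Y, ∀ ρ : Matrix S S ℂ, p.channel (J * ρ * Jᴴ) = T * ρ * Tᴴ

theorem LOCCProtocol.channel_smul (p : LOCCProtocol A' B' X Y) (c : ℂ)
    (ρ : Matrix (X × Y) (X × Y) ℂ) : p.channel (c • ρ) = c • p.channel ρ := by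
  induction p with
  | done => rfl
  | alice K hK next ih => simp [LOCCProtocol.channel, ih, Finset.smul_sum]
  | bob K hK next ih => simp [LOCCProtocol.channel, ih, Finset.smul_sum]

/-- The protocol with the roles of the two parties exchanged. -/
def LOCCProtocol.swap {X Y : Type} : LOCCProtocol A' B' X Y → LOCCProtocol B' A' Y X
  | .done => .done
  | @LOCCProtocol.alice _ _ _ _ _ _ iA dA iB dB i₁ d₁ iι K hK next =>
      @LOCCProtocol.bob _ _ _ _ _ _ iB dB iA dA i₁ d₁ iι K hK fun i => (next i).swap
  | @LOCCProtocol.bob _ _ _ _ _ _ iA dA iB dB i₁ d₁ iι K hK next =>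
      @LOCCProtocol.alice _ _ _ _ _ _ iB dB iA dA i₁ d₁ iι K hK fun i => (next i).swap

theorem kronecker_one_submatrix_swap [Fintype X] [DecidableEq X] [Fintype Y] [DecidableEq Y]
    (K : Matrix X' X ℂ) :
    (K ⊗ₖ (1 : Matrix Y Y ℂ)).submatrix Prod.swap Prod.swap = (1 : Matrix Y Y ℂ) ⊗ₖ K := by
  ext ⟨a, b⟩ ⟨c, d⟩
  simp [Matrix.kroneckerMap_apply, mul_comm]

theorem one_kronecker_submatrix_swap [Fintype X] [DecidableEq X] [Fintype Y] [DecidableEq Y]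
    (K : Matrix X' X ℂ) :
    ((1 : Matrix Y Y ℂ) ⊗ₖ K).submatrix Prod.swap Prod.swap = K ⊗ₖ (1 : Matrix Y Y ℂ) := by
  ext ⟨a, b⟩ ⟨c, d⟩
  simp [Matrix.kroneckerMap_apply, mul_comm]

theorem conjugate_submatrix_swap [Fintype X] [Fintype Y] {Y' : Type}
    (M : Matrix (X' × Y') (X × Y) ℂ) (ρ : Matrix (X × Y) (X × Y) ℂ) :
    M.submatrix Prod.swap Prod.swap * ρ.submatrix Prod.swap Prod.swap *
      (M.submatrix Prod.swap Prod.swap)ᴴ = (M * ρ * Mᴴ).submatrix Prod.swap Prod.swap := by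
  have e : (Prod.swap : Y × X → X × Y) = Equiv.prodComm Y X := rfl
  rw [Matrix.conjTranspose_submatrix, e, Matrix.submatrix_mul_equiv, Matrix.submatrix_mul_equiv]

theorem LOCCProtocol.channel_swap (p : LOCCProtocol A' B' X Y) (ρ : Matrix (X × Y) (X × Y) ℂ) :
    p.swap.channel (ρ.submatrix Prod.swap Prod.swap) =
      (p.channel ρ).submatrix Prod.swap Prod.swap := by
  induction p with
  | done => rfl
  | alice K hK next ih =>
    simp only [LOCCProtocol.swap, LOCCProtocol.channel, ← kronecker_one_submatrix_swap,
      conjugate_submatrix_swap, ih]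
    ext
    simp [Matrix.sum_apply]
  | bob K hK next ih =>
    simp only [LOCCProtocol.swap, LOCCProtocol.channel, ← one_kronecker_submatrix_swap,
      conjugate_submatrix_swap, ih]
    ext
    simp [Matrix.sum_apply]

variable [Fintype S]

theorem conjugate_submatrix_left (J : Matrix (X × Y) S ℂ) (ρ : Matrix S S ℂ) :
    J.submatrix Prod.swap id * ρ * (J.submatrix Prod.swap id)ᴴ =
      (J * ρ * Jᴴ).submatrix Prod.swap Prod.swap := by
  ext
  simp [Matrix.mul_apply]

theorem Realizable.swap {J : Matrix (X × Y) S ℂ} {T : Matrix (A' × B') S ℂ}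
    (h : Realizable J T) :
    Realizable (J.submatrix Prod.swap id) (T.submatrix Prod.swap id) := by
  obtain ⟨p, hp⟩ := h
  refine ⟨p.swap, fun ρ => ?_⟩
  rw [conjugate_submatrix_left, conjugate_submatrix_left, p.channel_swap, hp]

variable [Fintype X] [DecidableEq X] [Fintype Y] [DecidableEq Y] [Fintype X'] [DecidableEq X']

/-- A local measurement of Alice, in terms of its effect on purified states. -/
theorem Realizable.alice [Fintype ι] {J : Matrix (X × Y) S ℂ} {T : Matrix (A' × B') S ℂ}
    (K : ι → Matrix X' X ℂ) (hK : ∑ i, (K i)ᴴ * K i = 1) (c : ι → ℂ)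
    (hc : ∑ i, c i * star (c i) = 1) (J' : ι → Matrix (X' × Y) S ℂ)
    (hJ : ∀ i, (K i ⊗ₖ (1 : Matrix Y Y ℂ)) * J = c i • J' i) (h : ∀ i, Realizable (J' i) T) :
    Realizable J T := by
  choose p hp using h
  refine ⟨.alice K hK p, fun ρ => ?_⟩
  have key : ∀ i, (K i ⊗ₖ (1 : Matrix Y Y ℂ)) * (J * ρ * Jᴴ) * (K i ⊗ₖ (1 : Matrix Y Y ℂ))ᴴ =
      (c i * star (c i)) • (J' i * ρ * (J' i)ᴴ) := fun i => by
    have : (K i ⊗ₖ (1 : Matrix Y Y ℂ)) * (J * ρ * Jᴴ) * (K i ⊗ₖ (1 : Matrix Y Y ℂ))ᴴ =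
        ((K i ⊗ₖ (1 : Matrix Y Y ℂ)) * J) * ρ * ((K i ⊗ₖ (1 : Matrix Y Y ℂ)) * J)ᴴ := by
      simp only [Matrix.conjTranspose_mul, Matrix.mul_assoc]
    rw [this, hJ, Matrix.conjTranspose_smul, Matrix.smul_mul, Matrix.smul_mul, Matrix.mul_smul,
      smul_smul]
  simp only [LOCCProtocol.channel, key, LOCCProtocol.channel_smul, hp]
  rw [← Finset.sum_smul, hc, one_smul]

/-- The state `(1/√|K|) ∑ k, |xs s k⟩|ys s k⟩`, as a function of `s`. -/
noncomputable def sharedKet [Fintype K] (xs : S → K → X) (ys : S → K → Y) :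
    Matrix (X × Y) S ℂ :=
  Matrix.of fun p s =>
    ((√(Fintype.card K : ℝ))⁻¹ : ℝ) * ∑ k, if xs s k = p.1 ∧ ys s k = p.2 then (1 : ℂ) else 0

theorem sharedKet_submatrix_swap [Fintype K] (xs : S → K → X) (ys : S → K → Y) :
    (sharedKet xs ys).submatrix Prod.swap id = sharedKet ys xs := by
  ext
  simp [sharedKet, and_comm]

theorem Realizable.swap_sharedKet [Fintype K] {xs : S → K → X} {ys : S → K → Y}
    {T : Matrix (A' × B') S ℂ} (h : Realizable (sharedKet ys xs) (T.submatrix Prod.swap id)) :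
    Realizable (sharedKet xs ys) T := by
  simpa [sharedKet_submatrix_swap, Matrix.submatrix_submatrix] using h.swap

theorem kronecker_one_mul_sharedKet [Fintype K] (M : Matrix X' X ℂ) (xs : S → K → X)
    (ys : S → K → Y) (p : X' × Y) (s : S) :
    ((M ⊗ₖ (1 : Matrix Y Y ℂ)) * sharedKet xs ys) p s =
      ((√(Fintype.card K : ℝ))⁻¹ : ℝ) * ∑ k, if ys s k = p.2 then M p.1 (xs s k) else 0 := by
  obtain ⟨x', y⟩ := p
  simp only [Matrix.mul_apply, Matrix.kroneckerMap_apply, sharedKet, Matrix.of_apply,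
    Fintype.sum_prod_type, Matrix.one_apply, mul_left_comm _ (Complex.ofReal _), ← Finset.mul_sum]
  congr 1
  simp only [mul_ite, mul_one, mul_zero, Finset.mul_sum]
  rw [Finset.sum_congr rfl fun x _ => Finset.sum_comm, Finset.sum_comm]
  refine Finset.sum_congr rfl fun k _ => ?_
  rw [Finset.sum_eq_single (xs s k) (fun x _ hx => by simp [Ne.symm hx]) (by simp),
    Finset.sum_eq_single (ys s k) (fun z _ hz => by simp [Ne.symm hz]) (by simp)]
  simp [eq_comm]

/-- The Kraus operators of the measurement of `c`, followed by the substitution `φ`. -/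
def labelKraus [DecidableEq ι] (c : X → ι) (φ : X → X') (i : ι) : Matrix X' X ℂ :=
  Matrix.of fun x' x => if c x = i ∧ φ x = x' then 1 else 0

theorem sum_labelKraus [Fintype ι] [DecidableEq ι] (c : X → ι) (φ : X → X')
    (h : ∀ x z, c x = c z → φ x = φ z → x = z) :
    ∑ i, (labelKraus c φ i)ᴴ * labelKraus c φ i = 1 := by
  ext x z
  simp only [Matrix.sum_apply, Matrix.mul_apply, Matrix.conjTranspose_apply, labelKraus,
    Matrix.of_apply, apply_ite star, star_one, star_zero, ite_mul, one_mul, zero_mul, ite_and,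
    Finset.sum_ite_irrel, Finset.sum_const_zero, Finset.sum_ite_eq, Finset.mem_univ, if_true,
    Matrix.one_apply]
  by_cases hx : x = z
  · simp [hx]
  · rw [if_neg hx]
    split_ifs with h1 h2
    · exact absurd (h _ _ h1.symm h2.symm) hx
    · rfl
    · rfl

/-- Alice may replace her register by any other one carrying the same information. -/
theorem Realizable.relabel [Fintype K] [Nonempty X'] {xs : S → K → X} {xs' : S → K → X'}
    {ys : S → K → Y} {T : Matrix (A' × B') S ℂ} (h : Realizable (sharedKet xs' ys) T)
    (hxs : ∀ s k t l, xs s k = xs t l ↔ xs' s k = xs' t l) : Realizable (sharedKet xs ys) T := by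
  classical
  obtain ⟨φ, hφ⟩ : ∃ φ : X → X', ∀ s k, φ (xs s k) = xs' s k := by
    refine ⟨fun x => if hx : ∃ q : S × K, xs q.1 q.2 = x then xs' hx.choose.1 hx.choose.2
      else Classical.arbitrary X', fun s k => ?_⟩
    have hx : ∃ q : S × K, xs q.1 q.2 = xs s k := ⟨(s, k), rfl⟩
    simp only [dif_pos hx]
    exact (hxs _ _ _ _).1 hx.choose_spec
  let c : X → Option X := fun x => if ∃ s k, xs s k = x then none else some x
  have hc : ∀ s k, c (xs s k) = none := fun s k => if_pos ⟨s, k, rfl⟩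
  refine Realizable.alice (labelKraus c φ) (sum_labelKraus c φ fun x z h1 h2 => ?_)
    (fun i => if i = none then 1 else 0) (by simp) (fun _ => sharedKet xs' ys) (fun i => ?_)
    fun _ => h
  · by_cases hx : ∃ s k, xs s k = x <;> by_cases hz : ∃ s k, xs s k = z
    · obtain ⟨s, k, rfl⟩ := hx
      obtain ⟨t, l, rfl⟩ := hz
      rw [hφ, hφ] at h2
      exact (hxs _ _ _ _).2 h2
    · simp [c, hx, hz] at h1
    · simp [c, hx, hz] at h1
    · simpa [c, hx, hz] using h1
  · ext p s
    rw [kronecker_one_mul_sharedKet]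
    rcases i with _ | i
    · simp [labelKraus, hc, hφ, sharedKet, and_comm, -ite_and, ← ite_and]
    · simp [labelKraus, hc]

/-- Bob may replace his register by any other one carrying the same information. -/
theorem Realizable.relabel_right [Fintype K] [Nonempty X'] {ys : S → K → X} {ys' : S → K → X'}
    {xs : S → K → Y} {T : Matrix (A' × B') S ℂ} (h : Realizable (sharedKet xs ys') T)
    (hys : ∀ s k t l, ys s k = ys t l ↔ ys' s k = ys' t l) : Realizable (sharedKet xs ys) T :=
  .swap_sharedKet (.relabel (.swap_sharedKet (by simpa [Matrix.submatrix_submatrix] using h)) hys)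

variable [Fintype K] [Fintype H] [DecidableEq H] [AddCommGroup H]

theorem exists_factor {xs : S → K → X} {h : S → K → H}
    (hf : ∀ s k t l, xs s k = xs t l → h s k = h t l) : ∃ g : X → H, ∀ s k, g (xs s k) = h s k := by
  classical
  refine ⟨fun x => if hx : ∃ q : S × K, xs q.1 q.2 = x then h hx.choose.1 hx.choose.2
    else 0, fun s k => ?_⟩
  have hx : ∃ q : S × K, xs q.1 q.2 = xs s k := ⟨(s, k), rfl⟩
  simp only [dif_pos hx]
  exact hf _ _ _ _ hx.choose_spec

/-- Alice copies a value which she knows to Bob, consuming a maximally entangled state. -/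
theorem Realizable.send {xs : S → K → X} {ys : S → K → Y} {h : S → K → H}
    {T : Matrix (A' × B') S ℂ} (hr : Realizable (sharedKet xs fun s k => (ys s k, h s k)) T)
    (hf : ∀ s k t l, xs s k = xs t l → h s k = h t l) [Nonempty Y] :
    Realizable (sharedKet (fun s (k : K × H) => (xs s k.1, k.2))
      (fun s (k : K × H) => (ys s k.1, k.2))) T := by
  obtain ⟨g, hg⟩ := exists_factor hf
  have hH : (0 : ℝ) < Fintype.card H := by exact_mod_cast Fintype.card_pos
  refine Realizable.alice (labelKraus (fun x : X × H => x.2 - g x.1) Prod.fst)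
    (sum_labelKraus _ _ fun x z h1 h2 => ?_) (fun _ => ((√(Fintype.card H : ℝ))⁻¹ : ℝ)) ?_
    (fun i => sharedKet xs fun s k => (ys s k, i + h s k)) (fun i => ?_)
    (fun i => Realizable.relabel_right hr fun s k t l => ?_)
  · exact Prod.ext h2 (by simpa [h2] using h1)
  · have : (√(Fintype.card H : ℝ))⁻¹ * (√(Fintype.card H : ℝ))⁻¹ = (Fintype.card H : ℝ)⁻¹ := by
      rw [← mul_inv, Real.mul_self_sqrt hH.le]
    simp only [Complex.star_def, Complex.conj_ofReal, ← Complex.ofReal_mul, this,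
      Finset.sum_const, Finset.card_univ, nsmul_eq_mul]
    push_cast
    exact mul_inv_cancel₀ (by exact_mod_cast hH.ne')
  · ext ⟨x, y, l⟩ s
    rw [kronecker_one_mul_sharedKet]
    simp only [Matrix.smul_apply, sharedKet, Matrix.of_apply, labelKraus, Fintype.card_prod,
      Nat.cast_mul, Real.sqrt_mul (Nat.cast_nonneg _), mul_inv, Complex.ofReal_mul, smul_eq_mul,
      Fintype.sum_prod_type, hg]
    rw [mul_comm (Complex.ofReal _) (Complex.ofReal _), mul_assoc]
    congr 2
    refine Finset.sum_congr rfl fun k _ => ?_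
    have : ∀ m : H, (if (ys s k, m) = (y, l) then
        (if m - h s k = i ∧ xs s k = x then (1 : ℂ) else 0) else 0) =
        if m = l then (if ys s k = y ∧ l - h s k = i ∧ xs s k = x then 1 else 0) else 0 := by
      intro m
      by_cases hm : m = l
      · subst hm
        by_cases hy : ys s k = y <;> simp [hy]
      · simp [hm]
    simp only [this, Finset.sum_ite_eq', Finset.mem_univ, if_true]
    refine if_congr ?_ rfl rfl
    rw [Prod.mk.injEq, sub_eq_iff_eq_add, eq_comm (a := l)]
    tauto
  · simp

/-- Bob copies a value which he knows to Alice, consuming a maximally entangled state. -/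
theorem Realizable.send_right {ys : S → K → X} {xs : S → K → Y} {h : S → K → H}
    {T : Matrix (A' × B') S ℂ} (hr : Realizable (sharedKet (fun s k => (xs s k, h s k)) ys) T)
    (hf : ∀ s k t l, ys s k = ys t l → h s k = h t l) [Nonempty Y] :
    Realizable (sharedKet (fun s (k : K × H) => (xs s k.1, k.2))
      (fun s (k : K × H) => (ys s k.1, k.2))) T :=
  .swap_sharedKet (.send (.swap_sharedKet (by simpa [Matrix.submatrix_submatrix] using hr)) hf)

/-- The Kraus operators of the measurement of the last register in the Fourier basis. -/
noncomputable def fourierKraus (ψ : AddChar H ℂ) : Matrix X (X × H) ℂ :=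
  Matrix.of fun x' x => if x.1 = x' then ((√(Fintype.card H : ℝ))⁻¹ : ℝ) * ψ x.2 else 0

theorem inv_sqrt_card_mul_self :
    (((√(Fintype.card H : ℝ))⁻¹ : ℝ) : ℂ) * ((√(Fintype.card H : ℝ))⁻¹ : ℝ) =
      (Fintype.card H : ℂ)⁻¹ := by
  rw [← Complex.ofReal_mul, ← mul_inv, Real.mul_self_sqrt (Nat.cast_nonneg _)]
  simp

theorem sum_fourierKraus :
    ∑ ψ : AddChar H ℂ, (fourierKraus ψ : Matrix X (X × H) ℂ)ᴴ *
      (fourierKraus ψ : Matrix X (X × H) ℂ) = 1 := by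
  have hH : (Fintype.card H : ℂ) ≠ 0 := by exact_mod_cast Fintype.card_ne_zero
  ext ⟨x, l⟩ ⟨z, m⟩
  simp only [Matrix.sum_apply, Matrix.mul_apply, Matrix.conjTranspose_apply, fourierKraus,
    Matrix.of_apply, apply_ite star, star_zero, ite_mul, zero_mul, Finset.sum_ite_eq,
    Finset.mem_univ, if_true, Matrix.one_apply, Prod.mk.injEq]
  by_cases hx : x = z
  · subst hx
    have : ∀ ψ : AddChar H ℂ, star ((((√(Fintype.card H : ℝ))⁻¹ : ℝ) : ℂ) * ψ l) *
        ((((√(Fintype.card H : ℝ))⁻¹ : ℝ) : ℂ) * ψ m) = (Fintype.card H : ℂ)⁻¹ * ψ (m - l) := by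
      intro ψ
      rw [star_mul', Complex.star_def, Complex.conj_ofReal, ← AddChar.map_neg_eq_conj,
        mul_mul_mul_comm, inv_sqrt_card_mul_self, ← AddChar.map_add_eq_mul, neg_add_eq_sub]
    simp only [if_true, this, ← Finset.mul_sum, AddChar.sum_apply_eq_ite, sub_eq_zero, true_and]
    by_cases hl : m = l
    · simp [hl, hH]
    · simp [hl, Ne.symm hl]
  · simp [hx, Ne.symm hx]

/-- A local measurement of Bob, in terms of its effect on purified states. -/
theorem Realizable.bob [Fintype ι] {J : Matrix (Y × X) S ℂ} {T : Matrix (A' × B') S ℂ}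
    (K : ι → Matrix X' X ℂ) (hK : ∑ i, (K i)ᴴ * K i = 1) (c : ι → ℂ)
    (hc : ∑ i, c i * star (c i) = 1) (J' : ι → Matrix (Y × X') S ℂ)
    (hJ : ∀ i, ((1 : Matrix Y Y ℂ) ⊗ₖ K i) * J = c i • J' i) (h : ∀ i, Realizable (J' i) T) :
    Realizable J T := by
  have := Realizable.alice (J := J.submatrix Prod.swap id) (T := T.submatrix Prod.swap id) K hK c hc
    (fun i => (J' i).submatrix Prod.swap id) (fun i => ?_) (fun i => (h i).swap)
  · simpa [Matrix.submatrix_submatrix] using this.swap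
  · rw [← one_kronecker_submatrix_swap]
    have e : (Prod.swap : X × Y → Y × X) = Equiv.prodComm X Y := rfl
    rw [e, Matrix.submatrix_mul_equiv, hJ]
    rfl

/-- Alice may erase a value which is known to Bob. -/
theorem Realizable.erase {xs : S → K → X} {ys : S → K → Y} {h : S → K → H}
    {T : Matrix (A' × B') S ℂ} (hr : Realizable (sharedKet xs ys) T)
    (hf : ∀ s k t l, ys s k = ys t l → h s k = h t l) :
    Realizable (sharedKet (fun s k => (xs s k, h s k)) ys) T := by
  obtain ⟨g, hg⟩ := exists_factor hf
  have hH : (Fintype.card H : ℂ) ≠ 0 := by exact_mod_cast Fintype.card_ne_zero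
  refine Realizable.alice (fun ψ : AddChar H ℂ => fourierKraus ψ) sum_fourierKraus
    (fun _ => ((√(Fintype.card H : ℝ))⁻¹ : ℝ)) ?_
    (fun ψ => ((1 : Matrix X X ℂ) ⊗ₖ Matrix.diagonal fun y => ψ (g y)) * sharedKet xs ys)
    (fun ψ => ?_) (fun ψ => ?_)
  · simp only [Complex.star_def, Complex.conj_ofReal, inv_sqrt_card_mul_self, Finset.sum_const,
      Finset.card_univ, nsmul_eq_mul]
    rw [AddChar.card_eq]
    exact mul_inv_cancel₀ hH
  · ext ⟨x, y⟩ s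
    rw [kronecker_one_mul_sharedKet, Matrix.smul_apply, ← Matrix.diagonal_one,
      Matrix.diagonal_kronecker_diagonal, Matrix.diagonal_mul]
    simp only [sharedKet, Matrix.of_apply, fourierKraus, smul_eq_mul, one_mul]
    rw [mul_left_comm (ψ (g y)), mul_left_comm (Complex.ofReal (√(Fintype.card H : ℝ))⁻¹),
      ← mul_assoc (Complex.ofReal (√(Fintype.card H : ℝ))⁻¹)]
    congr 1
    rw [Finset.mul_sum]
    refine Finset.sum_congr rfl fun k _ => ?_
    by_cases hy : ys s k = y
    · subst hy
      by_cases hx : xs s k = x <;> simp [hx, hg]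
    · simp [hy]
  · refine Realizable.bob (ι := Unit)
      (fun _ => (Matrix.diagonal fun y => ψ (-g y) : Matrix Y Y ℂ)) ?_ (fun _ => 1) (by simp)
      (fun _ => sharedKet xs ys) (fun _ => ?_) (fun _ => hr)
    · simp only [Finset.univ_unique, Finset.sum_singleton, Matrix.diagonal_conjTranspose,
        Matrix.diagonal_mul_diagonal, ← Matrix.diagonal_one]
      congr 1
      ext y
      rw [Pi.star_apply, Complex.star_def, ← AddChar.map_neg_eq_conj, ← AddChar.map_add_eq_mul]
      simp
    · rw [← Matrix.mul_assoc, ← Matrix.mul_kronecker_mul, Matrix.one_mul,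
        Matrix.diagonal_mul_diagonal, one_smul]
      simp [← AddChar.map_add_eq_mul]

/-- Bob may erase a value which is known to Alice. -/
theorem Realizable.erase_right {ys : S → K → X} {xs : S → K → Y} {h : S → K → H}
    {T : Matrix (A' × B') S ℂ} (hr : Realizable (sharedKet xs ys) T)
    (hf : ∀ s k t l, xs s k = xs t l → h s k = h t l) :
    Realizable (sharedKet xs fun s k => (ys s k, h s k)) T :=
  .swap_sharedKet (.erase (.swap_sharedKet (by simpa [Matrix.submatrix_submatrix] using hr)) hf)

end Protocols

section Counting

/-- In a zero-one matrix of rank at most `r` given by a factorization, whose rows take equal values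
on `d` independent functionals, there are at most `2 ^ (r - d)` different rows. -/
theorem exists_row_code {I J : Type} {r d : ℕ} (P : I → Fin r → ℂ) (Q : J → Fin r → ℂ)
    (h01 : ∀ i j, P i ⬝ᵥ Q j = 0 ∨ P i ⬝ᵥ Q j = 1) (F : Set (Fin r → ℂ))
    (hd : F.ncard = d)
    (hF : LinearIndepOn ℂ id F) (hconst : ∀ q ∈ F, ∀ i i', P i ⬝ᵥ q = P i' ⬝ᵥ q) :
    ∃ c : I → Fin (2 ^ (r - d)), ∀ i i', c i = c i' → ∀ j, P i ⬝ᵥ Q j = P i' ⬝ᵥ Q j := by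
  classical
  subst hd
  obtain ⟨b, hbsub, hFb, hspan, hb⟩ :=
    exists_linearIndepOn_id_extension hF (Set.subset_union_left (t := Set.range Q))
  have hbf : b.Finite := hb.linearIndependent.finite
  have hbcard : b.ncard ≤ r := by
    have := hbf.fintype
    have h := hb.linearIndependent.fintype_card_le_finrank
    rwa [Module.finrank_fin_fun, ← Nat.card_eq_fintype_card, Nat.card_coe_set_eq] at h
  have := (hbf.subset (Set.sdiff_subset (t := F))).fintype
  have hcard : Fintype.card (↥(b \ F) → Bool) ≤ Fintype.card (Fin (2 ^ (r - F.ncard))) := by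
    rw [Fintype.card_fun, Fintype.card_bool, Fintype.card_fin, ← Nat.card_eq_fintype_card,
      Nat.card_coe_set_eq, Set.ncard_sdiff hFb (hbf.subset hFb)]
    exact Nat.pow_le_pow_right two_pos (Nat.sub_le_sub_right hbcard _)
  obtain ⟨e⟩ := Function.Embedding.nonempty_of_card_le hcard
  refine ⟨fun i => e fun q => decide (P i ⬝ᵥ q.1 = 1), fun i i' h j => ?_⟩
  have hq : ∀ q ∈ b, P i ⬝ᵥ q = P i' ⬝ᵥ q := by
    intro q hqb
    by_cases hqF : q ∈ F
    · exact hconst q hqF i i'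
    · obtain ⟨j, rfl⟩ := (hbsub hqb).resolve_left hqF
      have := congrFun (e.injective h) ⟨_, hqb, hqF⟩
      simp only [decide_eq_decide] at this
      rcases h01 i j with h1 | h1 <;> rcases h01 i' j with h2 | h2 <;> simp_all
  have hmem := hspan (Set.mem_union_right F ⟨j, rfl⟩)
  generalize Q j = v at hmem
  induction hmem using Submodule.span_induction with
  | mem q h => exact hq q h
  | zero => simp
  | add q q' _ _ h h' => rw [dotProduct_add, dotProduct_add, h, h']
  | smul a q _ h => rw [dotProduct_smul, dotProduct_smul, h]

variable {A B : Type} [DecidableEq A] [DecidableEq B]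

/-- For a bijection `f` of `A × B` of Schmidt rank at most four, the maps `fun a => (f (a, b)).1`
take at most eight values. -/
theorem exists_control_code (f : A × B → A × B) (S : Fin 4 → Matrix A A ℂ)
    (T : Fin 4 → Matrix B B ℂ)
    (hf : ∀ x y, ∑ j, S j y.1 x.1 * T j y.2 x.2 = if f x = y then 1 else 0) [Fintype A] [Nonempty A] [Fintype B] :
    ∃ g : B → Fin 8, ∀ b b', g b = g b' → ∀ a, (f (a, b)).1 = (f (a, b')).1 := by
  rcases isEmpty_or_nonempty B with hB | ⟨⟨b₀⟩⟩
  · exact ⟨fun _ => 0, fun b => hB.elim b⟩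
  obtain ⟨a₀⟩ := ‹Nonempty A›
  let P : B → Fin 4 → ℂ := fun b j => ∑ b', T j b' b
  let Q : A × A → Fin 4 → ℂ := fun q j => S j q.2 q.1
  have hPQ : ∀ b q, P b ⬝ᵥ Q q = if (f (q.1, b)).1 = q.2 then 1 else 0 := by
    intro b q
    simp only [dotProduct, P, Q, Finset.sum_mul]
    rw [Finset.sum_comm]
    have := fun b' => hf (q.1, b) (q.2, b')
    simp only [mul_comm (S _ _ _)] at this
    simp only [this, Prod.ext_iff, ite_and]
    split_ifs <;> simp
  let φ : Fin 4 → ℂ := ∑ a, Q (a₀, a)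
  have hφ : ∀ b, P b ⬝ᵥ φ = 1 := by
    intro b
    simp only [φ, dotProduct_sum, hPQ]
    simp
  have hφ0 : φ ≠ 0 := fun h => by simpa [h] using hφ b₀
  obtain ⟨c, hc⟩ := exists_row_code P Q (fun b q => by rw [hPQ]; split_ifs <;> simp) {φ}
    (Set.ncard_singleton φ) (LinearIndepOn.singleton hφ0) (by simp [hφ])
  refine ⟨c, fun b b' h a => ?_⟩
  have := hc b b' h (a, (f (a, b)).1)
  rw [hPQ, hPQ, if_pos rfl] at this
  by_contra hne
  rw [if_neg (Ne.symm hne)] at this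
  exact one_ne_zero this

/-- For a bijection `f` of `A × B` of Schmidt rank at most four, there are at most sixteen
different blocks. -/
theorem exists_block_code (f : A × B → A × B) (S : Fin 4 → Matrix A A ℂ)
    (T : Fin 4 → Matrix B B ℂ)
    (hf : ∀ x y, ∑ j, S j y.1 x.1 * T j y.2 x.2 = if f x = y then 1 else 0) :
    ∃ τ : A → A → Fin 16, ∀ a a' c c', τ a a' = τ c c' →
      ∀ b b', f (a, b) = (a', b') ↔ f (c, b) = (c', b') := by
  let P : A × A → Fin 4 → ℂ := fun q j => S j q.2 q.1
  let Q : B × B → Fin 4 → ℂ := fun q j => T j q.2 q.1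
  have hPQ : ∀ p q, P p ⬝ᵥ Q q = if f (p.1, q.1) = (p.2, q.2) then 1 else 0 := fun p q =>
    hf (p.1, q.1) (p.2, q.2)
  obtain ⟨c, hc⟩ := exists_row_code P Q (fun b q => by rw [hPQ]; split_ifs <;> simp) ∅
    (Set.ncard_empty _) (linearIndepOn_empty ℂ id) (by simp)
  refine ⟨fun a a' => c (a, a'), fun a a' d d' h b b' => ?_⟩
  have := hc (a, a') (d, d') h (b, b')
  rw [hPQ, hPQ] at this
  by_cases h1 : f (a, b) = (a', b') <;> by_cases h2 : f (d, b) = (d', b') <;> simp_all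

/-- A permutation unitary comes from a permutation. -/
theorem IsPermutationUnitary.exists_equiv {n : Type} [Fintype n] [DecidableEq n]
    {U : Matrix n n ℂ} (hU : IsPermutationUnitary U) :
    ∃ f : n ≃ n, ∀ x y, U y x = if f x = y then 1 else 0 := by
  obtain ⟨hU, h01⟩ := hU
  have hUU := Matrix.mem_unitaryGroup_iff'.1 hU
  have hcol : ∀ x, ∃! y, U y x = 1 := by
    intro x
    have h := congrFun (congrFun hUU x) x
    rw [Matrix.mul_apply, Matrix.one_apply_eq] at h
    have h' : ∀ y, (star U) x y * U y x = if U y x = 1 then 1 else 0 := by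
      intro y
      rcases h01 y x with h | h <;> simp [Matrix.star_apply, h]
    simp only [h', Finset.sum_boole] at h
    have h1 : (Finset.univ.filter fun y => U y x = 1).card = 1 := by exact_mod_cast h
    obtain ⟨y, hy⟩ := Finset.card_eq_one.1 h1
    have hy' : ∀ z, U z x = 1 ↔ z = y := fun z => by
      simpa using congrArg (z ∈ ·) hy
    exact ⟨y, (hy' y).2 rfl, fun z hz => (hy' z).1 hz⟩
  choose f hf1 hf2 using hcol
  have hf : ∀ x y, U y x = if f x = y then 1 else 0 := by
    intro x y
    split_ifs with h
    · rw [← h]; exact hf1 x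
    · exact (h01 y x).resolve_right fun h' => h (hf2 x y h').symm
  have hinj : Function.Injective f := by
    intro x z hxz
    by_contra hne
    have h := congrFun (congrFun hUU x) z
    rw [Matrix.mul_apply, Matrix.one_apply_ne hne] at h
    simp [Matrix.star_apply, hf, hxz] at h
  exact ⟨Equiv.ofBijective f (Finite.injective_iff_bijective.1 hinj), hf⟩

end Counting

theorem withMaxEntangled_eq {A B : Type} [Fintype A] [DecidableEq A] [Fintype B] [DecidableEq B]
    (N : ℕ) (ρ : Matrix (A × B) (A × B) ℂ) :
    withMaxEntangled N ρ =
      sharedKet (fun (s : A × B) (k : Fin N) => (s.1, k)) (fun s k => (s.2, k)) * ρ *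
        (sharedKet (fun (s : A × B) (k : Fin N) => (s.1, k)) (fun s k => (s.2, k)))ᴴ := by
  have key : ∀ (p : (A × Fin N) × (B × Fin N)) (s : A × B),
      sharedKet (fun (s : A × B) (k : Fin N) => (s.1, k)) (fun s k => (s.2, k)) p s =
        if s = (p.1.1, p.2.1) then maxEntangledKet N (p.1.2, p.2.2) else 0 := by
    rintro ⟨⟨a, k⟩, b, l⟩ ⟨a', b'⟩
    by_cases ha : a' = a
    · by_cases hb : b' = b
      · by_cases hkl : k = l
        · simp [sharedKet, maxEntangledKet, ha, hb, hkl, Finset.filter_eq']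
        · have : ∀ m, ¬(m = k ∧ m = l) := fun m h => hkl (h.1.symm.trans h.2)
          simp [sharedKet, maxEntangledKet, ha, hb, hkl, this]
      · simp [sharedKet, hb]
    · simp [sharedKet, ha]
  ext x y
  simp only [Matrix.mul_apply, Matrix.conjTranspose_apply, key, withMaxEntangled, Matrix.of_apply,
    ite_mul, zero_mul, Finset.sum_ite_eq', Finset.mem_univ, if_true, apply_ite star, star_zero,
    mul_ite, mul_zero]
  ring

theorem Realizable.reindex {A' B' X Y S K K' : Type} [Fintype S] [Fintype K] [Fintype K']
    [DecidableEq X] [DecidableEq Y] (e : K' ≃ K) {xs : S → K → X} {ys : S → K → Y}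
    {T : Matrix (A' × B') S ℂ}
    (h : Realizable (sharedKet (fun s k => xs s (e k)) fun s k => ys s (e k)) T) :
    Realizable (sharedKet xs ys) T := by
  convert h using 1
  ext p s
  simp only [sharedKet, Matrix.of_apply, Fintype.card_congr e]
  rw [← e.sum_comp]

theorem corollary1 (dA dB : ℕ) (U : Matrix (Fin dA × Fin dB) (Fin dA × Fin dB) ℂ)
    (hU : IsPermutationUnitary U) (hr : HasSchmidtRank U 4) :
    ImplementableWithEbits U 10.71 := by
  obtain ⟨f, hf⟩ := hU.exists_equiv
  obtain ⟨S, T, hS, hT, hST⟩ := hr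
  have hA : Nonempty (Fin dA) := by
    by_contra h
    rw [not_nonempty_iff] at h
    exact hS.ne_zero 0 (Subsingleton.elim _ _)
  have hB : Nonempty (Fin dB) := by
    by_contra h
    rw [not_nonempty_iff] at h
    exact hT.ne_zero 0 (Subsingleton.elim _ _)
  have hfST : ∀ x y, ∑ j, S j y.1 x.1 * T j y.2 x.2 = if f x = y then 1 else 0 := by
    intro x y
    rw [← hf, hST]
    simp [Matrix.sum_apply, Matrix.kroneckerMap_apply]
  obtain ⟨g, hg⟩ := exists_control_code f S T hfST
  obtain ⟨g', hg'⟩ := exists_control_code f.symm (fun j => (S j)ᵀ) (fun j => (T j)ᵀ)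
    fun x y => by
      simp only [Matrix.transpose_apply, hfST, Equiv.symm_apply_eq]
      exact if_congr eq_comm rfl rfl
  obtain ⟨τ, hτ⟩ := exists_block_code f S T hfST
  refine ⟨8 * 16 * 8, by norm_num, ?_, ?_⟩
  · have : (2 : ℝ) ^ (10 : ℝ) = ((8 * 16 * 8 : ℕ) : ℝ) := by
      rw [show (10 : ℝ) = ((10 : ℕ) : ℝ) by norm_num, Real.rpow_natCast]
      norm_num
    rw [← this, Real.logb_rpow two_pos (by norm_num)]
    norm_num
  suffices h : Realizable (sharedKet (fun (s : Fin dA × Fin dB) (k : Fin (8 * 16 * 8)) => (s.1, k))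
      (fun s k => (s.2, k))) U by
    obtain ⟨p, hp⟩ := h
    exact ⟨p, fun ρ _ => by rw [withMaxEntangled_eq, hp]⟩
  have e : ((Unit × Fin 8) × Fin 16) × Fin 8 ≃ Fin (8 * 16 * 8) := Fintype.equivOfCardEq (by simp)
  have hinv : ∀ s : Fin dA × Fin dB, f.symm ((f s).1, (f s).2) = s := fun s => f.symm_apply_apply s
  refine .reindex e ?_
  refine .relabel (xs' := fun s k => (((s.1, k.1.1.2), k.1.2), k.2)) ?_ (by
    simp [Prod.ext_iff, and_assoc])
  refine .relabel_right (ys' := fun s k => (((s.2, k.1.1.2), k.1.2), k.2)) ?_ (by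
    simp [Prod.ext_iff, and_assoc])
  -- Bob tells Alice how he controls her register.
  refine (Realizable.send_right (T := U) (K := (Unit × Fin 8) × Fin 16) (H := Fin 8)
    (xs := fun s k => ((s.1, k.1.2), k.2))
    (ys := fun s k => ((s.2, k.1.2), k.2))
    (h := fun s _ => g s.2) ?_ (by simp_all) :)
  refine .relabel (xs' := fun s k => ((((s.1, (f s).1), k.1.2), k.2), g s.2)) ?_ ?_
  swap
  · rintro ⟨a, b⟩ k ⟨a', b'⟩ l
    simp only [Prod.mk.injEq]
    constructor
    · rintro ⟨⟨⟨rfl, h1⟩, h2⟩, h3⟩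
      exact ⟨⟨⟨⟨rfl, hg b b' h3 a⟩, h1⟩, h2⟩, h3⟩
    · tauto
  refine .erase ?_ (by simp_all)
  -- Alice tells Bob which block he has to apply.
  refine (Realizable.send (T := U) (K := Unit × Fin 8) (H := Fin 16) (xs := fun s k => ((s.1, (f s).1), k.2))
    (ys := fun s k => (s.2, k.2)) (h := fun s _ => τ s.1 (f s).1) ?_ (by simp_all) :)
  refine .relabel_right (ys' := fun s k => (((f s).2, k.2), τ s.1 (f s).1)) ?_ ?_
  swap
  · rintro ⟨a, b⟩ k ⟨a', b'⟩ l
    simp only [Prod.mk.injEq]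
    refine and_congr_left fun h => and_congr_left fun _ => ?_
    have hb := (hτ _ _ _ _ h b (f (a, b)).2).1 rfl
    constructor
    · rintro rfl
      rw [hb]
    · intro h'
      exact (Prod.ext_iff.1 (f.injective (hb.trans (Prod.ext rfl h')))).2
  refine .erase_right ?_ (by simp_all)
  -- Bob tells Alice how to invert his control.
  refine (Realizable.send_right (T := U) (K := Unit) (H := Fin 8) (xs := fun s _ => (s.1, (f s).1)) (ys := fun s _ => (f s).2)
    (h := fun s _ => g' (f s).2) ?_ (by simp_all) :)
  refine .relabel (xs' := fun s _ => ((f s).1, g' (f s).2)) ?_ ?_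
  swap
  · intro s k t l
    simp only [Prod.mk.injEq]
    refine ⟨by tauto, fun ⟨h1, h2⟩ => ⟨⟨?_, h1⟩, h2⟩⟩
    have := hg' _ _ h2 (f s).1
    rwa [hinv, h1, hinv] at this
  refine .erase ?_ (by simp_all)
  refine ⟨.done, fun ρ => ?_⟩
  have : sharedKet (fun (s : Fin dA × Fin dB) (_ : Unit) => (f s).1) (fun s _ => (f s).2) = U := by
    ext y x
    simp [sharedKet, hf, Prod.ext_iff]
  rw [this]
  rfl
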